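/- Let $F_2^\infty=\bigoplus_{\mathbb N}F_2$ be the space of finitely supported columns over the field $F_2$ with two elements, and let $GL(\infty,F_2)$ be the group of invertible $\mathbb N\times\mathbb N$ matrices over $F_2$ that differ from the identity matrix $I$ in only finitely many entries, acting on $F_2^\infty$ by left multiplication. Put $G=GL(\infty,F_2)\ltimes F_2^\infty$, so that $g v g^{-1}=g(v)$ for $g\in GL(\infty,F_2)$ and $v\in F_2^\infty$. For $x\in G$ let $u_x$ be the unitary on $\ell^2(G)$ with $u_x\delta_y=\delta_{xy}$ for $y\in G$. Let $L(G)\subseteq B(\ell^2(G))$ be the von Neumann algebra generated by all $u_x$, $x\in G$, and for a subgroup $N\le G$ let $L(N)\subseteq L(G)$ be the von Neumann subalgebra generated by the $u_n$, $n\in N$. For $g\in GL(\infty,F_2)$ let $R(g-I)\subseteq F_2^\infty$ be the (finite) range of $g-I$ and put $$f_g=\frac{1}{\#R(g-I)}\sum_{v\in R(g-I)}u_v .$$ Let $\mathcal M_{exo}$ be the von Neumann algebra generated by $L(F_2^\infty)$ and all the elements $u_gf_g$, $g\in GL(\infty,F_2)$. Then $\mathcal M_{exo}$ is a $G$-invariant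 von Neumann subalgebra of $L(G)$, that is, $\mathcal M_{exo}\subseteq L(G)$ and $u_x m u_x^*\in\mathcal M_{exo}$ for all $x\in G$ and $m\in\mathcal M_{exo}$; and it is exotic, that is, there is no normal subgroup $N\trianglelefteq G$ with $\mathcal M_{exo}=L(N)$. -/

import Mathlib

open scoped ENNReal

noncomputable section

/-! ### Von Neumann algebras generated by sets of operators -/

section Generated

variable {H : Type*} [NormedAddCommGroup H] [InnerProductSpace ℂ H] [CompleteSpace H]

/-- The von Neumann algebra `(S ∪ S*)''` generated by a set `S` of bounded operators. -/
def vonNeumannGen (S : Set (H →L[ℂ] H)) : VonNeumannAlgebra H where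
  toStarSubalgebra :=
    StarSubalgebra.centralizer ℂ (StarSubalgebra.centralizer ℂ S : Set (H →L[ℂ] H))
  centralizer_centralizer' := by simp

theorem coe_vonNeumannGen (S : Set (H →L[ℂ] H)) :
    (vonNeumannGen S : Set (H →L[ℂ] H)) = Set.centralizer (Set.centralizer (S ∪ star S)) := by
  have h : (StarSubalgebra.centralizer ℂ S : Set (H →L[ℂ] H)) ∪
      star (StarSubalgebra.centralizer ℂ S : Set (H →L[ℂ] H)) =
      (StarSubalgebra.centralizer ℂ S : Set (H →L[ℂ] H)) := by
    refine Set.union_eq_left.2 fun x hx => ?_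
    have hx' : star x ∈ StarSubalgebra.centralizer ℂ S := hx
    have hx2 := star_mem hx'
    rwa [star_star] at hx2
  change ((StarSubalgebra.centralizer ℂ
    (StarSubalgebra.centralizer ℂ S : Set (H →L[ℂ] H)) : StarSubalgebra ℂ (H →L[ℂ] H)) :
      Set (H →L[ℂ] H)) = _
  rw [StarSubalgebra.coe_centralizer, h, StarSubalgebra.coe_centralizer]

/-- `vonNeumannGen S` is the smallest von Neumann algebra containing `S`. -/
theorem vonNeumannGen_le_iff {S : Set (H →L[ℂ] H)} {M : VonNeumannAlgebra H} :
    vonNeumannGen S ≤ M ↔ S ⊆ (M : Set (H →L[ℂ] H)) := by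
  constructor
  · intro h x hx
    apply h
    rw [← SetLike.mem_coe, coe_vonNeumannGen]
    exact Set.subset_centralizer_centralizer (Or.inl hx)
  · intro h
    have h2 : S ∪ star S ⊆ (M : Set (H →L[ℂ] H)) := by
      rintro x (hx | hx)
      · exact h hx
      · have : star x ∈ M := h hx
        simpa using star_mem this
    intro x hx
    rw [← SetLike.mem_coe, coe_vonNeumannGen] at hx
    have := Set.centralizer_subset (Set.centralizer_subset h2) hx
    rwa [VonNeumannAlgebra.centralizer_centralizer] at this

end Generated

/-! ### Group von Neumann algebras -/

section GroupVN

/-- The Hilbert space `ℓ²(Γ)`. -/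
abbrev EllTwo (Γ : Type*) : Type _ := lp (fun _ : Γ => ℂ) 2

theorem memℓp_comp_equiv {Γ : Type*} (e : Γ ≃ Γ) (ξ : EllTwo Γ) :
    Memℓp (fun x => (ξ : Γ → ℂ) (e x)) 2 := by
  have h := lp.memℓp ξ
  rw [memℓp_gen_iff (by norm_num)] at h ⊢
  exact (e.summable_iff (f := fun x => ‖(ξ : Γ → ℂ) x‖ ^ (2 : ℝ≥0∞).toReal)).2 h

variable {Γ : Type*} [Group Γ]

/-- The left translation isometry `ξ ↦ (x ↦ ξ (g⁻¹ x))` of `ℓ²(Γ)`. -/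
def shiftIsometry (g : Γ) : EllTwo Γ →ₗᵢ[ℂ] EllTwo Γ where
  toFun ξ := ⟨fun x => (ξ : Γ → ℂ) (g⁻¹ * x), memℓp_comp_equiv (Equiv.mulLeft g⁻¹) ξ⟩
  map_add' _ _ := by ext x; rfl
  map_smul' _ _ := by ext x; rfl
  norm_map' ξ := by
    rw [lp.norm_eq_tsum_rpow (by norm_num), lp.norm_eq_tsum_rpow (by norm_num)]
    congr 1
    exact (Equiv.mulLeft g⁻¹).tsum_eq (fun x => ‖(ξ : Γ → ℂ) x‖ ^ (2 : ℝ≥0∞).toReal)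

/-- The shift operator `u_g` on `ℓ²(Γ)`. -/
def shift (g : Γ) : EllTwo Γ →L[ℂ] EllTwo Γ := (shiftIsometry g).toContinuousLinearMap

theorem shift_apply (g : Γ) (ξ : EllTwo Γ) (x : Γ) :
    (shift g ξ : Γ → ℂ) x = (ξ : Γ → ℂ) (g⁻¹ * x) := rfl

/-- `u_g δ_h = δ_{gh}`. -/
theorem shift_single [DecidableEq Γ] (g h : Γ) :
    shift g (lp.single 2 h (1 : ℂ)) = lp.single 2 (g * h) (1 : ℂ) := by
  ext x
  rw [shift_apply, lp.single_apply, lp.single_apply]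
  simp only [Pi.single_apply, inv_mul_eq_iff_eq_mul]

/-- The group von Neumann algebra `L(Γ) ⊆ B(ℓ²(Γ))`, generated by all `u_g`. -/
def groupVN (Γ : Type*) [Group Γ] : VonNeumannAlgebra (EllTwo Γ) :=
  vonNeumannGen (Set.range (shift : Γ → EllTwo Γ →L[ℂ] EllTwo Γ))

/-- For a subgroup `N` of `Γ`, the algebra `L(N)` viewed inside `L(Γ)`: the von Neumann algebra
on `ℓ²(Γ)` generated by the `u_n` with `n ∈ N`. -/
def subgroupVN (N : Subgroup Γ) : VonNeumannAlgebra (EllTwo Γ) :=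
  vonNeumannGen (shift '' (N : Set Γ))

/-- `M` is a `Γ`-invariant von Neumann subalgebra of `L(Γ)`. -/
def IsInvariantSubalgebra (M : VonNeumannAlgebra (EllTwo Γ)) : Prop :=
  M ≤ groupVN Γ ∧ ∀ g : Γ, ∀ m ∈ M, shift g * m * star (shift g) ∈ M

/-- `M` is not of the form `L(N)` with `N` a normal subgroup of `Γ`. -/
def IsExotic (M : VonNeumannAlgebra (EllTwo Γ)) : Prop :=
  ¬ ∃ N : Subgroup Γ, N.Normal ∧ M = subgroupVN N

end GroupVN

/-! ### The group `GL(∞, F₂) ⋉ F₂^∞` -/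

/-- `F₂^∞`: finitely supported columns over the field with two elements. -/
abbrev FTwoInf : Type := ℕ →₀ ZMod 2

/-- The infinite matrix of a linear map of `F₂^∞` in the standard basis. -/
def infMatrix (g : FTwoInf →ₗ[ZMod 2] FTwoInf) : Matrix ℕ ℕ (ZMod 2) :=
  fun i j => g (Finsupp.single j 1) i

theorem finite_entries_iff (g : FTwoInf →ₗ[ZMod 2] FTwoInf) :
    {p : ℕ × ℕ | infMatrix g p.1 p.2 ≠ (1 : Matrix ℕ ℕ (ZMod 2)) p.1 p.2}.Finite ↔
      {j : ℕ | g (Finsupp.single j 1) ≠ Finsupp.single j 1}.Finite := by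
  have key : ∀ i j : ℕ, (1 : Matrix ℕ ℕ (ZMod 2)) i j =
      (Finsupp.single j (1 : ZMod 2) : FTwoInf) i := by
    intro i j
    simp [Matrix.one_apply, Finsupp.single_apply, eq_comm]
  constructor
  · intro h
    refine (h.image Prod.snd).subset ?_
    intro j hj
    obtain ⟨i, hi⟩ := Finsupp.ne_iff.1 hj
    exact ⟨(i, j), by simpa [infMatrix, key] using hi, rfl⟩
  · intro h
    refine (h.biUnion (t := fun j => (fun i => (i, j)) ''
      ((g (Finsupp.single j 1) - Finsupp.single j 1 : FTwoInf).support : Set ℕ))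
      (fun j _ => (Finset.finite_toSet _).image _)).subset ?_
    rintro ⟨i, j⟩ hij
    have hij' : g (Finsupp.single j 1) i ≠ (Finsupp.single j (1 : ZMod 2) : FTwoInf) i := by
      simpa [infMatrix, key] using hij
    simp only [Set.mem_iUnion]
    refine ⟨j, fun h' => hij' (by rw [h']), i, ?_, rfl⟩
    simpa [sub_eq_zero] using hij'

/-- `GL(∞, F₂)`: the invertible infinite matrices over `F₂` that differ from the identity matrix
in finitely many entries, realized as linear automorphisms of `F₂^∞`. -/
def GLInf : Subgroup (FTwoInf ≃ₗ[ZMod 2] FTwoInf) where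
  carrier := {g | {p : ℕ × ℕ | infMatrix (g : FTwoInf →ₗ[ZMod 2] FTwoInf) p.1 p.2 ≠
    (1 : Matrix ℕ ℕ (ZMod 2)) p.1 p.2}.Finite}
  one_mem' := by
    simp only [Set.mem_ofPred_eq, finite_entries_iff]
    simp
  mul_mem' := by
    intro a b ha hb
    simp only [Set.mem_ofPred_eq, finite_entries_iff] at *
    refine (ha.union hb).subset ?_
    intro j hj
    by_contra hcon
    simp only [Set.mem_union, Set.mem_ofPred_eq, not_or, not_not, LinearEquiv.coe_coe] at hcon
    apply hj
    simp [hcon.1, hcon.2]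
  inv_mem' := by
    intro a ha
    simp only [Set.mem_ofPred_eq, finite_entries_iff] at *
    refine ha.subset ?_
    intro j hj hcon
    apply hj
    change a.symm _ = _
    rw [LinearEquiv.symm_apply_eq]
    exact hcon.symm

/-- The action of `GL(∞, F₂)` on `F₂^∞` by group automorphisms, `v ↦ g(v)`. -/
def glAction : GLInf →* MulAut (Multiplicative FTwoInf) where
  toFun g := AddEquiv.toMultiplicative (g : FTwoInf ≃ₗ[ZMod 2] FTwoInf).toAddEquiv
  map_one' := rfl
  map_mul' _ _ := rfl

/-- The group `GL(∞, F₂) ⋉ F₂^∞`. -/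
abbrev AffInf : Type := SemidirectProduct (Multiplicative FTwoInf) GLInf glAction

/-- The inclusion `GL(∞, F₂) → GL(∞, F₂) ⋉ F₂^∞`. -/
def ofGL (g : GLInf) : AffInf := SemidirectProduct.inr g

/-- The inclusion `F₂^∞ → GL(∞, F₂) ⋉ F₂^∞`. -/
def ofVec (v : FTwoInf) : AffInf := SemidirectProduct.inl (Multiplicative.ofAdd v)

/-- `g v g⁻¹ = g(v)` in `GL(∞, F₂) ⋉ F₂^∞`. -/
theorem ofGL_mul_ofVec_mul_inv (g : GLInf) (v : FTwoInf) :
    ofGL g * ofVec v * (ofGL g)⁻¹ = ofVec ((g : FTwoInf ≃ₗ[ZMod 2] FTwoInf) v) := by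
  have h := SemidirectProduct.inl_aut (φ := glAction) g (Multiplicative.ofAdd v)
  rw [map_inv] at h
  exact h.symm

/-- The normal subgroup `F₂^∞` of `GL(∞, F₂) ⋉ F₂^∞`. -/
def vecSubgroup : Subgroup AffInf :=
  (SemidirectProduct.inl : Multiplicative FTwoInf →* AffInf).range

/-- The range `R(g - I)`. -/
def rangeSubId (g : GLInf) : Submodule (ZMod 2) FTwoInf :=
  LinearMap.range (((g : FTwoInf ≃ₗ[ZMod 2] FTwoInf) : FTwoInf →ₗ[ZMod 2] FTwoInf) -
    LinearMap.id)

theorem finite_rangeSubId (g : GLInf) : (rangeSubId g : Set FTwoInf).Finite := by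
  obtain ⟨g, hg⟩ := g
  have hfin := (finite_entries_iff (g : FTwoInf →ₗ[ZMod 2] FTwoInf)).1 hg
  set D : FTwoInf →ₗ[ZMod 2] FTwoInf := (g : FTwoInf →ₗ[ZMod 2] FTwoInf) - LinearMap.id with hD
  set S : Set FTwoInf := (fun j => D (Finsupp.single j 1)) ''
    {j : ℕ | (g : FTwoInf →ₗ[ZMod 2] FTwoInf) (Finsupp.single j 1) ≠ Finsupp.single j 1} with hS
  have hSfin : S.Finite := hfin.image _
  have hle : LinearMap.range D ≤ Submodule.span (ZMod 2) S := by
    rintro _ ⟨v, rfl⟩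
    induction v using Finsupp.induction_linear with
    | zero => simp
    | add a b ha hb => rw [map_add]; exact add_mem ha hb
    | single j c =>
      have hc : (Finsupp.single j c : FTwoInf) = c • Finsupp.single j 1 := by simp
      rw [hc, map_smul]
      apply Submodule.smul_mem
      by_cases hj : (g : FTwoInf →ₗ[ZMod 2] FTwoInf) (Finsupp.single j 1) = Finsupp.single j 1
      · have : D (Finsupp.single j 1) = 0 := by
          simp only [hD, LinearMap.sub_apply, hj, LinearMap.id_apply, sub_self]
        rw [this]
        exact zero_mem _
      · exact Submodule.subset_span ⟨j, hj, rfl⟩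
  have : FiniteDimensional (ZMod 2) (Submodule.span (ZMod 2) S) :=
    FiniteDimensional.span_of_finite _ hSfin
  have : Finite (Submodule.span (ZMod 2) S) := Module.finite_of_finite (ZMod 2)
  exact (Set.toFinite (Submodule.span (ZMod 2) S : Set FTwoInf)).subset hle

/-- The element `f_g = (1 / #R(g - I)) ∑_{v ∈ R(g - I)} u_v`. -/
def rangeAverage (g : GLInf) : EllTwo AffInf →L[ℂ] EllTwo AffInf :=
  (1 / ((finite_rangeSubId g).toFinset.card : ℂ)) •
    ∑ v ∈ (finite_rangeSubId g).toFinset, shift (ofVec v)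

/-- The von Neumann algebra `M_exo` generated by `L(F₂^∞)` and the elements `u_g f_g`. -/
def exoAlgebra : VonNeumannAlgebra (EllTwo AffInf) :=
  vonNeumannGen ((subgroupVN vecSubgroup : Set (EllTwo AffInf →L[ℂ] EllTwo AffInf)) ∪
    Set.range (fun g : GLInf => shift (ofGL g) * rangeAverage g))

end

/-! Invariance is checked on generators. Since `F₂^∞` is normal, `L(F₂^∞)` is stable under
conjugation. An element `h` of `GLInf` carries `R(g - I)` onto `R(hgh⁻¹ - I)`, so `u_h` conjugates
`u_g f_g` to the generator of `hgh⁻¹` (`conj_rangeAverage`). A vector `v` satisfies `v g v⁻¹ = g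
(g⁻¹v - v)` with `g⁻¹v - v ∈ R(g - I)`, and `f_g` absorbs this translation, so `u_v` fixes `u_g
f_g`.

For exoticness, the closed subspace `rangeInvariant` contains `δ_1` and is stable under `M_exo`
(`apply_mem_rangeInvariant`). For `g ≠ 1` it does not contain `δ_g = u_g δ_1`, hence `u_g ∉ M_exo`.
If `M_exo` were `L(N)`, all of `M_exo δ_1` would be supported on `N`; but `u_g f_g δ_1` has the
nonzero coefficient `1 / #R(g - I)` at `g`, so `g ∈ N` and `u_g ∈ M_exo`, a contradiction. -/

/-! ### Double commutants: conjugation and invariant subspaces -/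

section Generated

variable {H : Type*} [NormedAddCommGroup H] [InnerProductSpace ℂ H] [CompleteSpace H]

theorem mem_vonNeumannGen_iff {S : Set (H →L[ℂ] H)} {m : H →L[ℂ] H} :
    m ∈ vonNeumannGen S ↔
      ∀ t : H →L[ℂ] H, (∀ s ∈ S, s * t = t * s ∧ star s * t = t * star s) → t * m = m * t := by
  rw [← SetLike.mem_coe, coe_vonNeumannGen]
  refine ⟨fun h t ht => h t ?_, fun h t ht => h t fun s hs => ⟨ht s (Or.inl hs), ht _ (Or.inr ?_)⟩⟩
  · rintro s (hs | hs)
    · exact (ht s hs).1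
    · simpa using (ht _ hs).2
  · simpa using hs

theorem subset_vonNeumannGen (S : Set (H →L[ℂ] H)) :
    S ⊆ (vonNeumannGen S : Set (H →L[ℂ] H)) :=
  vonNeumannGen_le_iff.1 le_rfl

/-- If conjugation by a unitary maps generators into `M`, then it maps the generated
von Neumann algebra into `M`. -/
theorem conj_mem_of_mem_vonNeumannGen {S : Set (H →L[ℂ] H)} {M : VonNeumannAlgebra H}
    {u : H →L[ℂ] H} (hu : star u * u = 1) (hu' : u * star u = 1)
    (h : ∀ s ∈ S, u * s * star u ∈ M) {m : H →L[ℂ] H} (hm : m ∈ vonNeumannGen S) :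
    u * m * star u ∈ M := by
  rw [← M.commutant_commutant, VonNeumannAlgebra.mem_commutant_iff]
  intro t ht
  rw [VonNeumannAlgebra.mem_commutant_iff] at ht
  -- For `t` in the commutant of `M`, commuting with `u s u*` is the same as `s` commuting with `u*
  -- t u`. This turns the claim into a double commutant statement about `S`.
  have key : ∀ s : H →L[ℂ] H, u * s * star u * t = t * (u * s * star u) →
      s * (star u * t * u) = star u * t * u * s := by
    intro s hs
    calc s * (star u * t * u) = (star u * u) * s * (star u * t * u) := by rw [hu, one_mul]
      _ = star u * (u * s * star u * t) * u := by simp only [mul_assoc]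
      _ = star u * t * u * s * (star u * u) := by rw [hs]; simp only [mul_assoc]
      _ = _ := by rw [hu, mul_one]
  have hc := mem_vonNeumannGen_iff.1 hm (star u * t * u) fun s hs =>
    ⟨key s (ht _ (h s hs)), key (star s) (ht _ ?_)⟩
  · calc t * (u * m * star u) = (u * star u) * t * (u * m * star u) := by rw [hu', one_mul]
      _ = u * (star u * t * u * m) * star u := by simp only [mul_assoc]
      _ = u * m * star u * t * (u * star u) := by rw [hc]; simp only [mul_assoc]
      _ = _ := by rw [hu', mul_one]
  · have := star_mem (h s hs)
    simpa [mul_assoc] using this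

/-- A closed subspace that is invariant under the generators and their adjoints is invariant
under the generated von Neumann algebra. -/
theorem apply_mem_of_mem_vonNeumannGen {S : Set (H →L[ℂ] H)} {K : Submodule ℂ H}
    (hK : IsClosed (K : Set H)) (hS : ∀ s ∈ S, ∀ ξ ∈ K, s ξ ∈ K)
    (hS' : ∀ s ∈ S, ∀ ξ ∈ K, star s ξ ∈ K) {m : H →L[ℂ] H} (hm : m ∈ vonNeumannGen S)
    {ξ : H} (hξ : ξ ∈ K) : m ξ ∈ K := by
  have : CompleteSpace K := hK.completeSpace_coe
  have hE (s : H →L[ℂ] H) (h : ∀ ξ ∈ K, s ξ ∈ K) :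
      K.starProjection * s * K.starProjection = s * K.starProjection := by
    ext ξ
    exact K.starProjection_eq_self_iff.2 (h _ (K.starProjection_apply_mem ξ))
  have hsa : star K.starProjection = K.starProjection :=
    isStarProjection_starProjection.isSelfAdjoint
  -- With `p` the projection onto `K`, invariance under `s` gives `p s p = s p`, and the adjoint of
  -- the relation for `s*` gives `p s p = p s`. So `p` lies in the commutant of the generators.
  have hcomm (s : H →L[ℂ] H) (h : ∀ ξ ∈ K, s ξ ∈ K) (h' : ∀ ξ ∈ K, star s ξ ∈ K) :
      s * K.starProjection = K.starProjection * s := by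
    have h2 := congrArg star (hE (star s) h')
    simp only [star_mul, star_star, hsa] at h2
    rw [← hE s h, mul_assoc, h2]
  have hc := mem_vonNeumannGen_iff.1 hm K.starProjection fun s hs =>
    ⟨hcomm s (hS s hs) (hS' s hs), hcomm _ (hS' s hs) (by simpa using hS s hs)⟩
  have h3 := DFunLike.congr_fun hc ξ
  rw [mul_apply_eq_comp, mul_apply_eq_comp,
    K.starProjection_eq_self_iff.2 hξ] at h3
  exact K.starProjection_eq_self_iff.1 h3

end Generated

/-! ### Translation operators and supports in `ℓ²(Γ)` -/

section GroupVN

variable {Γ : Type*} [Group Γ]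

theorem shift_mul (g h : Γ) : shift (g * h) = shift g * shift h := by
  ext ξ x
  simp [shift_apply, mul_assoc]

theorem shift_one : shift (1 : Γ) = 1 := by
  ext ξ x
  simp [shift_apply]

theorem star_shift (g : Γ) : star (shift g) = shift g⁻¹ := by
  have h : star (shift g) * shift g = 1 :=
    (ContinuousLinearMap.norm_map_iff_adjoint_comp_self (shift g)).1 (shiftIsometry g).norm_map
  calc star (shift g) = star (shift g) * (shift g * shift g⁻¹) := by
        rw [← shift_mul, mul_inv_cancel, shift_one, mul_one]
    _ = shift g⁻¹ := by rw [← mul_assoc, h, one_mul]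

theorem shift_conj (g h : Γ) : shift g * shift h * star (shift g) = shift (g * h * g⁻¹) := by
  rw [star_shift, shift_mul, shift_mul]

theorem star_shift_mul_shift (g : Γ) : star (shift g) * shift g = 1 := by
  rw [star_shift, ← shift_mul, inv_mul_cancel, shift_one]

theorem shift_mul_star_shift (g : Γ) : shift g * star (shift g) = 1 := by
  rw [star_shift, ← shift_mul, mul_inv_cancel, shift_one]

theorem shift_mem_groupVN (g : Γ) : shift g ∈ groupVN Γ :=
  subset_vonNeumannGen _ ⟨g, rfl⟩

theorem shift_mem_subgroupVN {N : Subgroup Γ} {g : Γ} (hg : g ∈ N) : shift g ∈ subgroupVN N :=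
  subset_vonNeumannGen _ ⟨g, hg, rfl⟩

theorem subgroupVN_le_groupVN (N : Subgroup Γ) : subgroupVN N ≤ groupVN Γ := by
  refine vonNeumannGen_le_iff.2 ?_
  rintro _ ⟨g, -, rfl⟩
  exact shift_mem_groupVN g

theorem conj_mem_subgroupVN {N : Subgroup Γ} (hN : N.Normal) (g : Γ) {m : EllTwo Γ →L[ℂ] EllTwo Γ}
    (hm : m ∈ subgroupVN N) : shift g * m * star (shift g) ∈ subgroupVN N := by
  refine conj_mem_of_mem_vonNeumannGen (star_shift_mul_shift g) (shift_mul_star_shift g) ?_ hm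
  rintro _ ⟨n, hn, rfl⟩
  rw [shift_conj]
  exact shift_mem_subgroupVN (hN.conj_mem n hn g)

theorem continuous_ellTwo_apply {Γ : Type*} (x : Γ) : Continuous fun ξ : EllTwo Γ => (ξ : Γ → ℂ) x :=
  (lp.evalCLM (𝕜 := ℂ) (E := fun _ : Γ => ℂ) (p := 2) x).continuous

/-- The vectors of `ℓ²(Γ)` supported on a set. -/
def supportedOn {Γ : Type*} (N : Set Γ) : Submodule ℂ (EllTwo Γ) where
  carrier := {ξ | ∀ x ∉ N, (ξ : Γ → ℂ) x = 0}
  zero_mem' := by simp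
  add_mem' := by
    intro a b ha hb x hx
    simp [ha x hx, hb x hx]
  smul_mem' := by
    intro c a ha x hx
    simp [ha x hx]

theorem isClosed_supportedOn {Γ : Type*} (N : Set Γ) : IsClosed (supportedOn N : Set (EllTwo Γ)) := by
  have : (supportedOn N : Set (EllTwo Γ)) = ⋂ x ∈ Nᶜ, {ξ : EllTwo Γ | (ξ : Γ → ℂ) x = 0} := by
    ext ξ
    simp only [Set.mem_iInter]
    rfl
  rw [this]
  exact isClosed_biInter fun x _ => isClosed_eq (continuous_ellTwo_apply x) continuous_const

theorem shift_apply_mem_supportedOn {N : Subgroup Γ} {n : Γ} (hn : n ∈ N) {ξ : EllTwo Γ}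
    (hξ : ξ ∈ supportedOn (N : Set Γ)) : shift n ξ ∈ supportedOn (N : Set Γ) := by
  intro x hx
  rw [shift_apply]
  refine hξ _ fun h => hx ?_
  exact (Subgroup.mul_mem_cancel_left N (N.inv_mem hn)).1 h

/-- The operators in `L(N)` map `δ_1` to a vector supported on `N`. -/
theorem apply_single_one_eq_zero [DecidableEq Γ] {N : Subgroup Γ} {m : EllTwo Γ →L[ℂ] EllTwo Γ}
    (hm : m ∈ subgroupVN N) {x : Γ} (hx : x ∉ N) :
    (m (lp.single 2 1 (1 : ℂ)) : Γ → ℂ) x = 0 := by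
  refine apply_mem_of_mem_vonNeumannGen (isClosed_supportedOn (N : Set Γ)) ?_ ?_ hm ?_ x hx
  · rintro _ ⟨n, hn, rfl⟩ ξ hξ
    exact shift_apply_mem_supportedOn hn hξ
  · rintro _ ⟨n, hn, rfl⟩ ξ hξ
    rw [star_shift]
    exact shift_apply_mem_supportedOn (N.inv_mem hn) hξ
  · intro y hy
    have : y ≠ 1 := fun h => hy (h ▸ N.one_mem)
    rw [lp.single_apply, Pi.single_eq_of_ne this]

end GroupVN

/-! ### Relations between `u_v`, `u_g` and `f_g` -/

section Exo

theorem ofVec_add (v w : FTwoInf) : ofVec (v + w) = ofVec v * ofVec w := by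
  simp [ofVec]

theorem ofVec_neg (v : FTwoInf) : ofVec (-v) = (ofVec v)⁻¹ := by
  simp [ofVec]

theorem ofVec_zero : ofVec 0 = 1 := by
  simp [ofVec]

theorem ofVec_injective : Function.Injective ofVec := fun _ _ h =>
  Multiplicative.ofAdd.injective (SemidirectProduct.inl_injective h)

theorem ofGL_mul_ofVec (g : GLInf) (v : FTwoInf) :
    ofGL g * ofVec v = ofVec ((g : FTwoInf ≃ₗ[ZMod 2] FTwoInf) v) * ofGL g := by
  rw [← ofGL_mul_ofVec_mul_inv, inv_mul_cancel_right]

theorem ofGL_inv (g : GLInf) : ofGL g⁻¹ = (ofGL g)⁻¹ := map_inv SemidirectProduct.inr g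

theorem ofGL_mul (g h : GLInf) : ofGL (g * h) = ofGL g * ofGL h :=
  map_mul SemidirectProduct.inr g h

theorem normal_vecSubgroup : vecSubgroup.Normal := by
  rw [vecSubgroup, SemidirectProduct.range_inl_eq_ker_rightHom]
  infer_instance

theorem mem_rangeSubId {g : GLInf} {w : FTwoInf} :
    w ∈ rangeSubId g ↔ ∃ z, (g : FTwoInf ≃ₗ[ZMod 2] FTwoInf) z - z = w := by
  simp [rangeSubId, LinearMap.mem_range]

theorem glInf_inv_apply_apply (g : GLInf) (z : FTwoInf) :
    ((g⁻¹ : GLInf) : FTwoInf ≃ₗ[ZMod 2] FTwoInf) ((g : FTwoInf ≃ₗ[ZMod 2] FTwoInf) z) = z :=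
  (g : FTwoInf ≃ₗ[ZMod 2] FTwoInf).symm_apply_apply z

theorem glInf_apply_inv_apply (g : GLInf) (z : FTwoInf) :
    (g : FTwoInf ≃ₗ[ZMod 2] FTwoInf) (((g⁻¹ : GLInf) : FTwoInf ≃ₗ[ZMod 2] FTwoInf) z) = z :=
  (g : FTwoInf ≃ₗ[ZMod 2] FTwoInf).apply_symm_apply z

theorem glInf_mul_apply (g h : GLInf) (z : FTwoInf) :
    ((g * h : GLInf) : FTwoInf ≃ₗ[ZMod 2] FTwoInf) z =
      (g : FTwoInf ≃ₗ[ZMod 2] FTwoInf) ((h : FTwoInf ≃ₗ[ZMod 2] FTwoInf) z) := rfl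

/-- The vector `-gz` has the same image under `g⁻¹ - I` as `z` has under `g - I`. -/
theorem rangeSubId_inv (g : GLInf) : rangeSubId g⁻¹ = rangeSubId g := by
  have key : ∀ g : GLInf, rangeSubId g ≤ rangeSubId g⁻¹ := by
    intro g w hw
    obtain ⟨z, rfl⟩ := mem_rangeSubId.1 hw
    refine mem_rangeSubId.2 ⟨-(g : FTwoInf ≃ₗ[ZMod 2] FTwoInf) z, ?_⟩
    rw [map_neg, glInf_inv_apply_apply]
    abel
  exact le_antisymm (by simpa using key g⁻¹) (key g)

theorem apply_mem_rangeSubId_conj (h : GLInf) {g : GLInf} {w : FTwoInf} (hw : w ∈ rangeSubId g) :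
    (h : FTwoInf ≃ₗ[ZMod 2] FTwoInf) w ∈ rangeSubId (h * g * h⁻¹) := by
  obtain ⟨z, rfl⟩ := mem_rangeSubId.1 hw
  refine mem_rangeSubId.2 ⟨(h : FTwoInf ≃ₗ[ZMod 2] FTwoInf) z, ?_⟩
  rw [glInf_mul_apply, glInf_mul_apply, glInf_inv_apply_apply, map_sub]

theorem rangeAverage_eq_of_image {g h k : GLInf}
    (hk : ∀ w, w ∈ rangeSubId g ↔ (h : FTwoInf ≃ₗ[ZMod 2] FTwoInf) w ∈ rangeSubId k) :
    shift (ofGL h) * rangeAverage g * star (shift (ofGL h)) = rangeAverage k := by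
  have hmap : (finite_rangeSubId k).toFinset =
      (finite_rangeSubId g).toFinset.map
        (h : FTwoInf ≃ₗ[ZMod 2] FTwoInf).toEquiv.toEmbedding := by
    ext w
    simp only [Set.Finite.mem_toFinset, SetLike.mem_coe, Finset.mem_map_equiv, hk]
    exact iff_of_eq (congrArg (· ∈ rangeSubId k)
      (((h : FTwoInf ≃ₗ[ZMod 2] FTwoInf).apply_symm_apply w).symm))
  rw [rangeAverage, rangeAverage, hmap, Finset.card_map, Finset.sum_map, mul_smul_comm,
    smul_mul_assoc, Finset.mul_sum, Finset.sum_mul]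
  refine congrArg _ (Finset.sum_congr rfl fun v _ => ?_)
  rw [shift_conj, ofGL_mul_ofVec_mul_inv]
  rfl

theorem conj_rangeAverage (g h : GLInf) :
    shift (ofGL h) * rangeAverage g * star (shift (ofGL h)) = rangeAverage (h * g * h⁻¹) := by
  refine rangeAverage_eq_of_image fun w => ⟨apply_mem_rangeSubId_conj h, fun hw => ?_⟩
  have := apply_mem_rangeSubId_conj h⁻¹ hw
  simpa [mul_assoc, glInf_inv_apply_apply] using this

theorem rangeAverage_congr {g h : GLInf} (hgh : rangeSubId g = rangeSubId h) :
    rangeAverage g = rangeAverage h := by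
  simp only [rangeAverage, hgh]

theorem rangeAverage_inv (g : GLInf) : rangeAverage g⁻¹ = rangeAverage g :=
  rangeAverage_congr (rangeSubId_inv g)

/-- Translations by elements of the range are absorbed by the average. -/
theorem shift_ofVec_mul_rangeAverage {g : GLInf} {w : FTwoInf} (hw : w ∈ rangeSubId g) :
    shift (ofVec w) * rangeAverage g = rangeAverage g := by
  rw [rangeAverage, mul_smul_comm, Finset.mul_sum]
  refine congrArg _ (Finset.sum_bij (fun v _ => w + v) ?_ ?_ ?_ ?_)
  · intro v hv
    simp only [Set.Finite.mem_toFinset, SetLike.mem_coe] at hv ⊢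
    exact add_mem hw hv
  · intro a _ b _ hab
    exact add_left_cancel hab
  · intro b hb
    simp only [Set.Finite.mem_toFinset, SetLike.mem_coe] at hb
    refine ⟨-w + b, ?_, by simp⟩
    simp only [Set.Finite.mem_toFinset, SetLike.mem_coe]
    exact add_mem (neg_mem hw) hb
  · intro v _
    rw [ofVec_add, shift_mul]

theorem rangeAverage_mul_shift_ofVec {g : GLInf} (v : FTwoInf) :
    rangeAverage g * shift (ofVec v) = shift (ofVec v) * rangeAverage g := by
  rw [rangeAverage, mul_smul_comm, smul_mul_assoc, Finset.mul_sum, Finset.sum_mul]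
  refine congrArg _ (Finset.sum_congr rfl fun w _ => ?_)
  rw [← shift_mul, ← shift_mul, ← ofVec_add, ← ofVec_add, add_comm]

theorem star_rangeAverage (g : GLInf) : star (rangeAverage g) = rangeAverage g := by
  rw [rangeAverage, star_smul, star_sum]
  congr 1
  · simp
  · refine Finset.sum_bij (fun v _ => -v) ?_ ?_ ?_ ?_
    · intro v hv
      simpa using hv
    · intro a _ b _ hab
      exact neg_injective hab
    · intro b hb
      exact ⟨-b, by simpa using hb, by simp⟩
    · intro v _
      rw [star_shift, ofVec_neg]

/-- The operators `u_g f_g` are closed under adjoints because `f_g` is self-adjoint and commutes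
with `u_g`, as `g` preserves `R(g - I)`. -/
theorem star_shift_mul_rangeAverage (g : GLInf) :
    star (shift (ofGL g) * rangeAverage g) = shift (ofGL g⁻¹) * rangeAverage g⁻¹ := by
  -- Conjugating `g⁻¹` by itself gives the commutation of `u_g` with `f_g`.
  have h := conj_rangeAverage g⁻¹ g⁻¹
  rw [inv_inv, inv_mul_cancel_right, rangeAverage_inv, ofGL_inv, star_shift, inv_inv] at h
  rw [star_mul, star_rangeAverage, star_shift, rangeAverage_inv, ofGL_inv]
  conv_lhs => rw [← h]
  rw [mul_assoc, mul_assoc, ← shift_mul, mul_inv_cancel, shift_one, mul_one]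

/-! ### Invariance of `M_exo` under conjugation -/

theorem subgroupVN_le_exoAlgebra : subgroupVN vecSubgroup ≤ exoAlgebra := fun _ hx =>
  subset_vonNeumannGen _ (Or.inl hx)

theorem shift_mul_rangeAverage_mem_exoAlgebra (g : GLInf) :
    shift (ofGL g) * rangeAverage g ∈ exoAlgebra :=
  subset_vonNeumannGen _ (Or.inr ⟨g, rfl⟩)

theorem rangeAverage_mem_groupVN (g : GLInf) : rangeAverage g ∈ groupVN AffInf :=
  (groupVN AffInf).toStarSubalgebra.smul_mem
    (sum_mem (S := groupVN AffInf) fun _ _ => shift_mem_groupVN _) _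

theorem exoAlgebra_le_groupVN : exoAlgebra ≤ groupVN AffInf := by
  refine vonNeumannGen_le_iff.2 (Set.union_subset (subgroupVN_le_groupVN _) ?_)
  rintro _ ⟨g, rfl⟩
  exact mul_mem (shift_mem_groupVN _) (rangeAverage_mem_groupVN g)

theorem conj_ofGL_mem_exoAlgebra (h : GLInf) {m : EllTwo AffInf →L[ℂ] EllTwo AffInf}
    (hm : m ∈ exoAlgebra) : shift (ofGL h) * m * star (shift (ofGL h)) ∈ exoAlgebra := by
  refine conj_mem_of_mem_vonNeumannGen (star_shift_mul_shift _) (shift_mul_star_shift _) ?_ hm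
  rintro _ (hs | ⟨g, rfl⟩)
  · exact subgroupVN_le_exoAlgebra (conj_mem_subgroupVN normal_vecSubgroup _ hs)
  · have : shift (ofGL h) * (shift (ofGL g) * rangeAverage g) * star (shift (ofGL h)) =
        shift (ofGL (h * g * h⁻¹)) * rangeAverage (h * g * h⁻¹) := by
      rw [← conj_rangeAverage, ofGL_mul, ofGL_mul, ofGL_inv, ← shift_conj]
      simp only [mul_assoc]
      rw [← mul_assoc (star (shift (ofGL h))) (shift (ofGL h)), star_shift_mul_shift, one_mul]
    simp only [this]
    exact shift_mul_rangeAverage_mem_exoAlgebra _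

theorem conj_ofVec_mem_exoAlgebra (v : FTwoInf) {m : EllTwo AffInf →L[ℂ] EllTwo AffInf}
    (hm : m ∈ exoAlgebra) : shift (ofVec v) * m * star (shift (ofVec v)) ∈ exoAlgebra := by
  refine conj_mem_of_mem_vonNeumannGen (star_shift_mul_shift _) (shift_mul_star_shift _) ?_ hm
  rintro _ (hs | ⟨g, rfl⟩)
  · exact subgroupVN_le_exoAlgebra (conj_mem_subgroupVN normal_vecSubgroup _ hs)
  · have hw : ((g⁻¹ : GLInf) : FTwoInf ≃ₗ[ZMod 2] FTwoInf) v - v ∈ rangeSubId g := by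
      rw [← rangeSubId_inv]
      exact mem_rangeSubId.2 ⟨v, rfl⟩
    have hx : ofVec v * ofGL g * ofVec (-v) =
        ofGL g * ofVec (((g⁻¹ : GLInf) : FTwoInf ≃ₗ[ZMod 2] FTwoInf) v - v) := by
      rw [sub_eq_add_neg, ofVec_add, ← mul_assoc, ofGL_mul_ofVec, glInf_apply_inv_apply]
    have : shift (ofVec v) * (shift (ofGL g) * rangeAverage g) * star (shift (ofVec v)) =
        shift (ofGL g) * rangeAverage g := by
      rw [star_shift, ← ofVec_neg, mul_assoc, mul_assoc, rangeAverage_mul_shift_ofVec, ← mul_assoc,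
        ← mul_assoc, ← shift_mul, ← shift_mul, hx, shift_mul, mul_assoc,
        shift_ofVec_mul_rangeAverage hw]
    simp only [this]
    exact shift_mul_rangeAverage_mem_exoAlgebra _

theorem ofVec_mul_ofGL (x : AffInf) : ofVec x.left.toAdd * ofGL x.right = x :=
  SemidirectProduct.inl_left_mul_inr_right x

theorem isInvariantSubalgebra_exoAlgebra : IsInvariantSubalgebra exoAlgebra := by
  refine ⟨exoAlgebra_le_groupVN, fun x m hm => ?_⟩
  have := conj_ofVec_mem_exoAlgebra x.left.toAdd (conj_ofGL_mem_exoAlgebra x.right hm)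
  rw [← ofVec_mul_ofGL x, shift_mul, star_mul]
  simpa only [mul_assoc] using this

/-! ### An invariant subspace, and exoticness -/

/-- The vectors `ξ` of `ℓ²(GL(∞, F₂) ⋉ F₂^∞)` such that `ξ (w v g) = ξ (v g)` for all `w` in
`R(g - I)`. -/
def rangeInvariant : Submodule ℂ (EllTwo AffInf) where
  carrier := {ξ | ∀ x : AffInf, ∀ w ∈ rangeSubId x.right,
    (ξ : AffInf → ℂ) (ofVec w * x) = (ξ : AffInf → ℂ) x}
  zero_mem' := by simp
  add_mem' := by
    intro a b ha hb x w hw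
    simp [ha x w hw, hb x w hw]
  smul_mem' := by
    intro c a ha x w hw
    simp [ha x w hw]

theorem isClosed_rangeInvariant : IsClosed (rangeInvariant : Set (EllTwo AffInf)) := by
  have : (rangeInvariant : Set (EllTwo AffInf)) = ⋂ x : AffInf, ⋂ w ∈ rangeSubId x.right,
      {ξ : EllTwo AffInf | (ξ : AffInf → ℂ) (ofVec w * x) = (ξ : AffInf → ℂ) x} := by
    ext ξ
    simp only [Set.mem_iInter]
    rfl
  rw [this]
  exact isClosed_iInter fun x => isClosed_biInter fun w _ =>
    isClosed_eq (continuous_ellTwo_apply _) (continuous_ellTwo_apply _)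

/-- Vectors commute with each other, and multiplying by one leaves the `GLInf` component, hence the
relevant range, unchanged. -/
theorem shift_ofVec_mem_rangeInvariant (v : FTwoInf) {ξ : EllTwo AffInf}
    (hξ : ξ ∈ rangeInvariant) : shift (ofVec v) ξ ∈ rangeInvariant := by
  intro x w hw
  rw [shift_apply, shift_apply, ← ofVec_neg, ← mul_assoc, ← ofVec_add, add_comm, ofVec_add,
    mul_assoc]
  refine hξ _ w ?_
  simpa [ofVec] using hw

theorem rangeAverage_mem_rangeInvariant (g : GLInf) {ξ : EllTwo AffInf}
    (hξ : ξ ∈ rangeInvariant) : rangeAverage g ξ ∈ rangeInvariant := by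
  rw [rangeAverage, smul_apply, sum_apply]
  exact Submodule.smul_mem _ _ (Submodule.sum_mem _ fun v _ => shift_ofVec_mem_rangeInvariant v hξ)

/-- Evaluating at `w x` with `w = hz - z` produces the translation `g⁻¹w = -(g⁻¹z - z) + (g⁻¹hz -
z)`. The first summand lies in `R(g - I)` and is absorbed by `f_g`; the second lies in `R(g⁻¹h -
I)`, the range attached to `g⁻¹x`. -/
theorem shift_mul_rangeAverage_mem_rangeInvariant (g : GLInf) {ξ : EllTwo AffInf}
    (hξ : ξ ∈ rangeInvariant) : (shift (ofGL g) * rangeAverage g) ξ ∈ rangeInvariant := by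
  intro x w hw
  obtain ⟨z, rfl⟩ := mem_rangeSubId.1 hw
  set k : FTwoInf ≃ₗ[ZMod 2] FTwoInf := ((g⁻¹ : GLInf) : FTwoInf ≃ₗ[ZMod 2] FTwoInf) with hk
  set h : FTwoInf ≃ₗ[ZMod 2] FTwoInf := (x.right : FTwoInf ≃ₗ[ZMod 2] FTwoInf) with hh
  have hb : -(k z - z) ∈ rangeSubId g := by
    rw [← rangeSubId_inv]
    exact neg_mem (mem_rangeSubId.2 ⟨z, rfl⟩)
  have ha : k (h z) - z ∈ rangeSubId ((ofGL g)⁻¹ * x).right :=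
    mem_rangeSubId.2 ⟨z, rfl⟩
  have hsum : k (h z - z) = -(k z - z) + (k (h z) - z) := by
    rw [map_sub]
    abel
  have hη := rangeAverage_mem_rangeInvariant g hξ
  rw [mul_apply_eq_comp, shift_apply, shift_apply, ← mul_assoc, ← ofGL_inv,
    ofGL_mul_ofVec, ← hk, hsum, ofVec_add, mul_assoc, mul_assoc]
  have h1 := DFunLike.congr_fun (shift_ofVec_mul_rangeAverage (neg_mem hb)) ξ
  have h2 (y : AffInf) : (rangeAverage g ξ : AffInf → ℂ) (ofVec (-(k z - z)) * y) =
      (rangeAverage g ξ : AffInf → ℂ) y := by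
    conv_rhs => rw [← h1]
    rw [mul_apply_eq_comp, shift_apply, ofVec_neg (-(k z - z)), inv_inv]
  rw [h2, ofGL_inv]
  exact hη _ _ ha

theorem apply_mem_rangeInvariant {m : EllTwo AffInf →L[ℂ] EllTwo AffInf} (hm : m ∈ exoAlgebra)
    {ξ : EllTwo AffInf} (hξ : ξ ∈ rangeInvariant) : m ξ ∈ rangeInvariant := by
  -- `L(F₂^∞)` enters the generating set as a whole, so it is reduced to its own generators first.
  have hV : ∀ m ∈ subgroupVN vecSubgroup, ∀ ξ ∈ rangeInvariant, m ξ ∈ rangeInvariant := by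
    intro m hm ξ hξ
    refine apply_mem_of_mem_vonNeumannGen isClosed_rangeInvariant ?_ ?_ hm hξ
    · rintro _ ⟨_, ⟨v, rfl⟩, rfl⟩ η hη
      exact shift_ofVec_mem_rangeInvariant v.toAdd hη
    · rintro _ ⟨_, ⟨v, rfl⟩, rfl⟩ η hη
      have h := shift_ofVec_mem_rangeInvariant (-v.toAdd) hη
      rw [ofVec_neg] at h
      rw [star_shift]
      exact h
  refine apply_mem_of_mem_vonNeumannGen isClosed_rangeInvariant ?_ ?_ hm hξ
  · rintro s (hs | ⟨g, rfl⟩) η hη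
    · exact hV s hs η hη
    · exact shift_mul_rangeAverage_mem_rangeInvariant g hη
  · rintro s (hs | ⟨g, rfl⟩) η hη
    · exact hV _ (star_mem hs) η hη
    · simp only [star_shift_mul_rangeAverage]
      exact shift_mul_rangeAverage_mem_rangeInvariant g⁻¹ hη

/-- Over the identity of `GLInf` the range is zero; over any other component `δ_1` vanishes. -/
theorem single_one_mem_rangeInvariant [DecidableEq AffInf] :
    (lp.single 2 1 (1 : ℂ) : EllTwo AffInf) ∈ rangeInvariant := by
  intro x w hw
  by_cases hx : x.right = 1
  · obtain ⟨z, rfl⟩ := mem_rangeSubId.1 hw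
    simp [hx, ofVec_zero]
  · have h1 : x ≠ 1 := fun h => hx (by rw [h]; rfl)
    have h2 : ofVec w * x ≠ 1 := fun h => hx (by
      have := congrArg SemidirectProduct.right h
      simpa [ofVec] using this)
    rw [lp.single_apply, lp.single_apply, Pi.single_eq_of_ne h1, Pi.single_eq_of_ne h2]

/-- `M_exo` does not contain `u_g` for `g ≠ 1`. -/
theorem shift_ofGL_notMem_exoAlgebra {g : GLInf} (hg : g ≠ 1) : shift (ofGL g) ∉ exoAlgebra := by
  classical
  intro h
  obtain ⟨z, hz⟩ : ∃ z, (g : FTwoInf ≃ₗ[ZMod 2] FTwoInf) z ≠ z := by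
    by_contra! hcon
    exact hg (Subtype.ext (LinearEquiv.ext hcon))
  have hw : (g : FTwoInf ≃ₗ[ZMod 2] FTwoInf) z - z ∈ rangeSubId (ofGL g).right :=
    mem_rangeSubId.2 ⟨z, rfl⟩
  -- Membership of `δ_g` would equate its values at `w g` and `g`, where `w = gz - z ≠ 0`, that is,
  -- `0 = 1`.
  have h1 := apply_mem_rangeInvariant h single_one_mem_rangeInvariant (ofGL g) _ hw
  rw [shift_single, mul_one, lp.single_apply, lp.single_apply, Pi.single_eq_same,
    Pi.single_eq_of_ne] at h1
  · exact zero_ne_one h1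
  · intro h2
    rw [mul_eq_right, ← ofVec_zero] at h2
    exact hz (sub_eq_zero.1 (ofVec_injective h2))

/-- Only the summand `v = 0` of `f_g` contributes at `g`. -/
theorem shift_mul_rangeAverage_apply_single [DecidableEq AffInf] (g : GLInf) :
    ((shift (ofGL g) * rangeAverage g) (lp.single 2 1 (1 : ℂ)) : AffInf → ℂ) (ofGL g) =
      1 / ((finite_rangeSubId g).toFinset.card : ℂ) := by
  have hterm (v : FTwoInf) : (shift (ofVec v) (lp.single 2 1 (1 : ℂ)) : AffInf → ℂ) 1 =
      if v = 0 then 1 else 0 := by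
    rw [shift_single, mul_one, lp.single_apply, Pi.single_apply]
    refine if_congr ?_ rfl rfl
    rw [eq_comm, ← ofVec_zero, ofVec_injective.eq_iff]
  rw [mul_apply_eq_comp, shift_apply, inv_mul_cancel, rangeAverage,
    smul_apply, sum_apply, lp.coeFn_smul, Pi.smul_apply,
    lp.coeFn_sum, Finset.sum_apply]
  simp [hterm]

theorem exists_ne_one_glInf : ∃ g : GLInf, g ≠ 1 := by
  refine ⟨⟨Finsupp.domLCongr (Equiv.swap 0 1), ?_⟩, fun h => ?_⟩
  · change Set.Finite _
    rw [finite_entries_iff]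
    refine (Set.toFinite {0, 1}).subset fun j hj => ?_
    by_contra hcon
    simp only [Set.mem_insert_iff, Set.mem_singleton_iff, not_or] at hcon
    refine hj ?_
    simp [Equiv.swap_apply_of_ne_of_ne hcon.1 hcon.2]
  · have h1 := LinearEquiv.congr_fun (congrArg Subtype.val h) (Finsupp.single 0 1)
    have h2 := DFunLike.congr_fun h1 1
    simp at h2

theorem isExotic_exoAlgebra : IsExotic exoAlgebra := by
  classical
  rintro ⟨N, -, hN⟩
  obtain ⟨g, hg⟩ := exists_ne_one_glInf
  have hgN : ofGL g ∈ N := by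
    by_contra hcon
    have h := shift_mul_rangeAverage_mem_exoAlgebra g
    rw [hN] at h
    have h0 := apply_single_one_eq_zero h hcon
    rw [shift_mul_rangeAverage_apply_single, one_div, inv_eq_zero, Nat.cast_eq_zero,
      Finset.card_eq_zero] at h0
    have hmem : (0 : FTwoInf) ∈ (finite_rangeSubId g).toFinset := by simp
    simp [h0] at hmem
  exact shift_ofGL_notMem_exoAlgebra hg (hN ▸ shift_mem_subgroupVN hgN)

end Exo

theorem mainTheorem5 :
    IsInvariantSubalgebra exoAlgebra ∧ IsExotic exoAlgebra :=
  ⟨isInvariantSubalgebra_exoAlgebra, isExotic_exoAlgebra⟩
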